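/- Let $A=(a_{ij})_{0\le i,j\le r}$ be a symmetrizable generalized Cartan matrix of affine type and rank $r$, and let $\vec a,\vec c$ be the minimal positive integer vectors with $A\vec a=0$, $\vec c^{\,t}A=0$. Let $\mathfrak h$ be the complex vector space with basis $h_0,\dots,h_r,d$; let $\alpha_j,\varpi_j\in\mathfrak h^*$ be given by $\alpha_j(h_i)=a_{ij}$, $\alpha_j(d)=\delta_{j0}$, $\varpi_j(h_i)=\delta_{ij}$, $\varpi_j(d)=0$; let $\delta=\sum_i a_i\alpha_i$, $h^\vee=\sum_i c_i$, and let $\rho\in\mathfrak h^*$ satisfy $\rho(h_i)=1$ for all $i$. The level of $\lambda\in\mathfrak h^*$ is $\sum_i c_i\lambda(h_i)$. Let $(\,,)$ be the normalized invariant form, so that $(\lambda,\alpha_i)=\frac{c_i}{a_i}\lambda(h_i)$, and put $\langle\lambda,\gamma^\vee\rangle=2(\lambda,\gamma)/(\gamma,\gamma)$. Let $X^+=\{\lambda\in\mathfrak h^*:\lambda(h_i)\in\mathbb Z_{\ge0}\ \forall i\}$. Let $\Phi_{\mathrm{re}}$ be the set of real roots (the images of the simple roots $\alpha_i$ under the Weyl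 group) and $\Phi_{\mathrm{re}}^+$ the set of positive ones. For $i\in\{1,2,3\}$ let $\Phi_i^+$ be the set of $\gamma_0\in\Phi_{\mathrm{re}}^+$ such that, for $n\in\mathbb Z$, $\gamma_0+n\delta\in\Phi_{\mathrm{re}}$ if and only if $i\mid n$, and $\gamma_0-i\delta\notin\Phi_{\mathrm{re}}^+$. (Thus $\Phi_{\mathrm{re}}^+=\bigcup_{i=1}^3\{\gamma_0+t\delta:\gamma_0\in\Phi_i^+,\ t\in i\mathbb Z_{\ge0}\}$.) Let $p$ be a prime. For $\lambda,\mu\in X^+$ and $\gamma\in\Phi_{\mathrm{re}}^+$, the weight $\mu$ is $\gamma$-mirrored to $\lambda$ if, for some integer $e\ge1$, writing $\langle\lambda+\rho,\gamma^\vee\rangle=Mp^e+D$ with $M,D\in\mathbb Z$ and $0\le D<p^e$, one has $\mu=s_{\gamma,Mp^e}\cdot\lambda$, where $s_{\gamma,m}\cdot\lambda=\lambda-(\langle\lambda+\rho,\gamma^\vee\rangle-m)\gamma$; that is, $\mu=\lambda-D\gamma$. Let $Y^+$ be the set of $\lambda\in\sum_i\mathbb Z_{\ge0}\varpi_i$ such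 that some $\mu\in X^+$ is $\gamma$-mirrored to $\lambda$ for some $\gamma\in\Phi_{\mathrm{re}}^+$. **Proposition.** Let $\lambda\in X^+$ have level $\ell$ and let $\gamma_0\in\Phi_i^+$ for some $i\in\{1,2,3\}$. Then $C_i=\frac{2i}{(\gamma_0,\gamma_0)}(\ell+h^\vee)$ and $N=\langle\lambda+\rho,\gamma_0^\vee\rangle$ are integers, and the following hold. 1. If $\lambda-\gcd(C_i,p)\gamma_0\in X^+$, then some $\mu\in X^+$ is $\gamma$-mirrored to $\lambda$ for some $\gamma\in\Phi_{\mathrm{re}}^+$; if moreover $\lambda(d)=0$, then $\lambda\in Y^+$. 2. If $\lambda-\gcd(C_i,p)\gamma_0\in X^+$ and it is not the case that both $p^2\mid C_i$ and $p\mid N$, then $\mu$ and $\gamma$ as in 1 can be chosen with $\mu\neq\lambda$. 3. If $e\ge 0$ is an integer with $p^e\nmid C_i$ and $\lambda-\gcd(C_i,p^e)\gamma_0\in X^+$, then $\mu$ and $\gamma$ as in 1 can be chosen with $\mu\neq\lambda$. -/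

import Mathlib

namespace AffineWeyl

/-- `A`, with rows and columns indexed by `0, …, r`, is a symmetrizable generalized Cartan matrix
of affine type and of rank `r`. -/
structure IsAffineGCM {r : ℕ} (A : Matrix (Fin (r + 1)) (Fin (r + 1)) ℤ) : Prop where
  diag : ∀ i, A i i = 2
  offDiag_nonpos : ∀ i j, i ≠ j → A i j ≤ 0
  zero_symm : ∀ i j, A i j = 0 → A j i = 0
  indecomposable : ∀ S : Set (Fin (r + 1)), S.Nonempty → Sᶜ.Nonempty →
    ∃ i ∈ S, ∃ j ∈ Sᶜ, A i j ≠ 0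
  symmetrizable : ∃ ε : Fin (r + 1) → ℚ, (∀ i, ε i ≠ 0) ∧
    ∀ i j, ε i * (A i j : ℚ) = ε j * (A j i : ℚ)
  rank_eq : (A.map (Int.cast : ℤ → ℚ)).rank = r
  affine : ∃ u : Fin (r + 1) → ℤ, (∀ i, 0 < u i) ∧ A.mulVec u = 0

/-- `u` is the minimal positive integer vector with `A u = 0`. -/
def IsMarks {r : ℕ} (A : Matrix (Fin (r + 1)) (Fin (r + 1)) ℤ) (u : Fin (r + 1) → ℤ) : Prop :=
  IsLeast {v : Fin (r + 1) → ℤ | (∀ i, 0 < v i) ∧ A.mulVec v = 0} u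

/-- The Cartan subalgebra of the affine algebra: the complex vector space with basis
`h 0, …, h r` (first component) and the scaling element `d` (second component). -/
abbrev Cartan (r : ℕ) : Type := (Fin (r + 1) → ℂ) × ℂ

/-- The simple coroot `h i`. -/
def simpleCoroot {r : ℕ} (i : Fin (r + 1)) : Cartan r := (Pi.single i 1, 0)

/-- The scaling element `d`. -/
def scaling (r : ℕ) : Cartan r := (0, 1)

/-- The dual of the Cartan subalgebra. -/
abbrev Weight (r : ℕ) : Type := Module.Dual ℂ (Cartan r)

/-- The simple root `α j`, with `α j (h i) = A i j` and `α j (d) = 1` if `j = 0`, else `0`. -/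
noncomputable def simpleRoot {r : ℕ} (A : Matrix (Fin (r + 1)) (Fin (r + 1)) ℤ)
    (j : Fin (r + 1)) : Weight r :=
  (∑ i, (A i j : ℂ) • (LinearMap.proj i ∘ₗ LinearMap.fst ℂ (Fin (r + 1) → ℂ) ℂ)) +
    (if j = 0 then (1 : ℂ) else 0) • LinearMap.snd ℂ (Fin (r + 1) → ℂ) ℂ

/-- The fundamental weight `ϖ j`, with `ϖ j (h i) = 1` if `i = j`, else `0`, and `ϖ j (d) = 0`. -/
noncomputable def fundamentalWeight {r : ℕ} (j : Fin (r + 1)) : Weight r :=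
  LinearMap.proj j ∘ₗ LinearMap.fst ℂ (Fin (r + 1) → ℂ) ℂ

theorem simpleRoot_simpleCoroot {r : ℕ} (A : Matrix (Fin (r + 1)) (Fin (r + 1)) ℤ)
    (i j : Fin (r + 1)) : simpleRoot A j (simpleCoroot i) = (A i j : ℂ) := by
  by_cases h : j = 0 <;> simp [simpleRoot, simpleCoroot, Pi.single_apply, h]

theorem simpleRoot_scaling {r : ℕ} (A : Matrix (Fin (r + 1)) (Fin (r + 1)) ℤ)
    (j : Fin (r + 1)) : simpleRoot A j (scaling r) = if j = 0 then 1 else 0 := by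
  by_cases h : j = 0 <;> simp [simpleRoot, scaling, h]

/-- The root lattice: `g` stands for `∑ i, g i • α i`. -/
abbrev RootLattice (r : ℕ) : Type := Fin (r + 1) → ℤ

/-- The element of the dual Cartan subalgebra given by an element of the root lattice. -/
noncomputable def toWeight {r : ℕ} (A : Matrix (Fin (r + 1)) (Fin (r + 1)) ℤ)
    (g : RootLattice r) : Weight r :=
  ∑ i, (g i : ℂ) • simpleRoot A i

/-- The simple reflection `s i` on the root lattice, `g ↦ g - g (h i) α i`. -/
def simpleReflection {r : ℕ} (A : Matrix (Fin (r + 1)) (Fin (r + 1)) ℤ) (i : Fin (r + 1))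
    (g : RootLattice r) : RootLattice r :=
  g - (A.mulVec g i) • Pi.single i 1

/-- Real roots: the images of the simple roots under the group generated by the simple
reflections. -/
inductive IsRealRoot {r : ℕ} (A : Matrix (Fin (r + 1)) (Fin (r + 1)) ℤ) : RootLattice r → Prop
  | simple (i : Fin (r + 1)) : IsRealRoot A (Pi.single i 1)
  | reflect (i : Fin (r + 1)) (g : RootLattice r) :
      IsRealRoot A g → IsRealRoot A (simpleReflection A i g)

/-- Positive real roots. -/
def IsPosRealRoot {r : ℕ} (A : Matrix (Fin (r + 1)) (Fin (r + 1)) ℤ) (g : RootLattice r) :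
    Prop :=
  IsRealRoot A g ∧ ∀ i, 0 ≤ g i

/-- The set `Φ_i⁺`, where `a` is the coefficient vector of `δ`: the positive real roots `γ₀` whose
`δ`-string has period `i` (that is, `γ₀ + n δ` is a real root exactly for `n ∈ iℤ`) and which are
the first positive member of that string. So the positive real roots with period `i` are
the `γ₀ + t δ` with `γ₀ ∈ Φ_i⁺` and `t ∈ iℤ_{≥ 0}`. -/
def baseRoots {r : ℕ} (A : Matrix (Fin (r + 1)) (Fin (r + 1)) ℤ) (a : Fin (r + 1) → ℤ) (i : ℕ) :
    Set (RootLattice r) :=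
  {g | IsPosRealRoot A g ∧ (∀ n : ℤ, IsRealRoot A (g + n • a) ↔ (i : ℤ) ∣ n) ∧
    ¬ IsPosRealRoot A (g - (i : ℤ) • a)}

/-- The normalized invariant form `(μ, g)` of a weight `μ` with an element `g = ∑ g i α i` of the
root lattice. It is determined by `(μ, α i) = (c i / a i) μ (h i)`;
in particular `(α i, α j) = (c i / a i) A i j` and `(μ, δ) = μ (c)`. -/
noncomputable def form {r : ℕ} (a c : Fin (r + 1) → ℤ) (μ : Weight r) (g : RootLattice r) : ℂ :=
  ∑ i, (g i : ℂ) * ((c i : ℂ) / (a i : ℂ)) * μ (simpleCoroot i)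

/-- The norm `(g, g)`. -/
noncomputable def normSq {r : ℕ} (A : Matrix (Fin (r + 1)) (Fin (r + 1)) ℤ)
    (a c : Fin (r + 1) → ℤ) (g : RootLattice r) : ℂ :=
  form a c (toWeight A g) g

/-- `⟨μ, g^∨⟩ = 2 (μ, g) / (g, g)`. -/
noncomputable def corootPairing {r : ℕ} (A : Matrix (Fin (r + 1)) (Fin (r + 1)) ℤ)
    (a c : Fin (r + 1) → ℤ) (μ : Weight r) (g : RootLattice r) : ℂ :=
  2 * form a c μ g / normSq A a c g

/-- The value of a weight at the central element `∑ c i h i`. -/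
noncomputable def level {r : ℕ} (c : Fin (r + 1) → ℤ) (μ : Weight r) : ℂ :=
  μ (∑ i, (c i : ℂ) • simpleCoroot i)

/-- The set `X⁺` of dominant integral weights. -/
def dominantWeights (r : ℕ) : Set (Weight r) :=
  {μ | ∀ i, ∃ n : ℕ, μ (simpleCoroot i) = n}

/-- The affine reflection `s_{g,m}(μ) = μ - ⟨μ, g^∨⟩ g + m g`. -/
noncomputable def affineReflection {r : ℕ} (A : Matrix (Fin (r + 1)) (Fin (r + 1)) ℤ)
    (a c : Fin (r + 1) → ℤ) (g : RootLattice r) (m : ℤ) (μ : Weight r) : Weight r :=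
  μ - corootPairing A a c μ g • toWeight A g + (m : ℂ) • toWeight A g

/-- The dot action `s_{g,m} • μ = s_{g,m}(μ + ρ) - ρ`. -/
noncomputable def dotReflection {r : ℕ} (A : Matrix (Fin (r + 1)) (Fin (r + 1)) ℤ)
    (a c : Fin (r + 1) → ℤ) (ρ : Weight r) (g : RootLattice r) (m : ℤ) (μ : Weight r) :
    Weight r :=
  affineReflection A a c g m (μ + ρ) - ρ

/-- `μ` is `(g, e)`-mirrored to `ν`: both are dominant integral, `⟨ν + ρ, g^∨⟩ = M p^e + D` with
integers `M`, `D`, `0 ≤ D < p^e`, and `μ` is the nearest lower `p^e`-reflection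
`s_{g, M p^e} • ν` (which equals `ν - D g`). -/
def IsMirroredAt {r : ℕ} (A : Matrix (Fin (r + 1)) (Fin (r + 1)) ℤ) (a c : Fin (r + 1) → ℤ)
    (ρ : Weight r) (p : ℕ) (g : RootLattice r) (e : ℕ) (μ ν : Weight r) : Prop :=
  μ ∈ dominantWeights r ∧ ν ∈ dominantWeights r ∧
    ∃ M D : ℤ, corootPairing A a c (ν + ρ) g = ((M * (p : ℤ) ^ e + D : ℤ) : ℂ) ∧
      0 ≤ D ∧ D < (p : ℤ) ^ e ∧ μ = dotReflection A a c ρ g (M * (p : ℤ) ^ e) ν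

/-- `μ` is `g`-mirrored to `ν`. -/
def IsMirrored {r : ℕ} (A : Matrix (Fin (r + 1)) (Fin (r + 1)) ℤ) (a c : Fin (r + 1) → ℤ)
    (ρ : Weight r) (p : ℕ) (g : RootLattice r) (μ ν : Weight r) : Prop :=
  ∃ e : ℕ, 0 < e ∧ IsMirroredAt A a c ρ p g e μ ν

/-- The set `Y⁺`: nonnegative integral combinations `ν` of the fundamental weights such that some
dominant integral weight is `g`-mirrored to `ν` for some positive real root `g`. -/
def Yplus {r : ℕ} (A : Matrix (Fin (r + 1)) (Fin (r + 1)) ℤ) (a c : Fin (r + 1) → ℤ)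
    (ρ : Weight r) (p : ℕ) : Set (Weight r) :=
  {ν | (∃ ξ : Fin (r + 1) → ℕ, ν = ∑ i, (ξ i : ℂ) • fundamentalWeight i) ∧
    ∃ μ ∈ dominantWeights r, ∃ g, IsPosRealRoot A g ∧ IsMirrored A a c ρ p g μ ν}

end AffineWeyl

/-! Since `δ` is orthogonal to the root lattice and `(lam + ρ, δ) = ℓ + h^∨`, the coroot pairings of
`lam + ρ` along the string `γ₀ + k i δ` form the progression `N + k C`. Since `δ` kills every `h j`,
dominance of `lam - D γ` does not depend on the member `γ` of the string, and by convexity it holds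
for `0 ≤ D ≤ q` once it holds for `D = q`. It remains to find `k ≥ 0` and an exponent `e ≥ 1` such
that `N + k C` has remainder at most `q` modulo `p ^ e` (`exists_isMirrored`).

Suppose `p ^ e ∤ C` and `q = gcd(C, p ^ e) = p ^ f`, so `f < e` and `p ^ f` exactly divides `C`. If
`p ^ f ∣ N`, the progression reaches the residue `p ^ f` modulo `p ^ (f + 1)`; otherwise `N` itself
has a nonzero remainder modulo `p ^ f`. Either way `D ≠ 0`, so `μ ≠ lam`. If `p ∣ C` and `q = p`,
the remainder of `N` modulo `p` serves, but it may be zero. -/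

namespace AffineWeyl

variable {r : ℕ} {A : Matrix (Fin (r + 1)) (Fin (r + 1)) ℤ} {a c : Fin (r + 1) → ℤ}

/-! ### Bilinearity of the form -/

section Linearity

theorem toWeight_add (g h : RootLattice r) : toWeight A (g + h) = toWeight A g + toWeight A h := by
  simp [toWeight, add_smul, Finset.sum_add_distrib]

theorem toWeight_zsmul (n : ℤ) (g : RootLattice r) : toWeight A (n • g) = (n : ℂ) • toWeight A g := by
  simp [toWeight, Finset.smul_sum, mul_smul]

theorem toWeight_simpleCoroot (g : RootLattice r) (j : Fin (r + 1)) :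
    toWeight A g (simpleCoroot j) = (A.mulVec g j : ℂ) := by
  simp [toWeight, simpleRoot_simpleCoroot, Matrix.mulVec, dotProduct, mul_comm]

theorem form_add (μ : Weight r) (g h : RootLattice r) :
    form a c μ (g + h) = form a c μ g + form a c μ h := by
  simp only [form, ← Finset.sum_add_distrib]
  refine Finset.sum_congr rfl fun j _ => ?_
  simp only [Pi.add_apply, Int.cast_add]
  ring

theorem form_zsmul (μ : Weight r) (n : ℤ) (g : RootLattice r) :
    form a c μ (n • g) = n * form a c μ g := by
  simp only [form, Finset.mul_sum]
  refine Finset.sum_congr rfl fun j _ => ?_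
  simp only [Pi.smul_apply, smul_eq_mul, Int.cast_mul]
  ring

theorem form_single (μ : Weight r) (i : Fin (r + 1)) :
    form a c μ (Pi.single i 1) = (c i : ℂ) / a i * μ (simpleCoroot i) := by
  rw [form, Finset.sum_eq_single i] <;> simp +contextual

theorem form_weight_add (μ ν : Weight r) (g : RootLattice r) :
    form a c (μ + ν) g = form a c μ g + form a c ν g := by
  simp [form, mul_add, Finset.sum_add_distrib]

theorem form_weight_smul (z : ℂ) (μ : Weight r) (g : RootLattice r) :
    form a c (z • μ) g = z * form a c μ g := by
  simp only [form, Finset.mul_sum]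
  refine Finset.sum_congr rfl fun j _ => ?_
  simp only [LinearMap.smul_apply, smul_eq_mul]
  ring

end Linearity

/-! ### Symmetry of the form and its radical -/

section Symmetry

/-- The marks and comarks symmetrize an affine generalized Cartan matrix. -/
theorem IsAffineGCM.mul_symm (hA : IsAffineGCM A) (ha : IsMarks A a) (hc : IsMarks A.transpose c)
    (i j : Fin (r + 1)) : c i * a j * A i j = c j * a i * A j i := by
  obtain ⟨ε, hε0, hε⟩ := hA.symmetrizable
  have ha0 := ha.1.1
  have hA0 := ha.1.2
  have hc0 := hc.1.1
  have hC0 := hc.1.2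
  -- The left kernel of `A` is a line by the rank hypothesis. It contains `c` and, by
  -- symmetrizability, `ε i * a i`; so these are proportional, and `ε` can be traded for `c i / a
  -- i`.
  let T := (A.map (Int.cast : ℤ → ℚ)).transpose
  let u : Fin (r + 1) → ℚ := fun i => c i
  let v : Fin (r + 1) → ℚ := fun i => ε i * a i
  have hu : u ∈ LinearMap.ker T.mulVecLin := by
    rw [LinearMap.mem_ker, Matrix.mulVecLin_apply]
    funext k
    have h := congrFun hC0 k
    simp only [Matrix.mulVec, dotProduct, Matrix.transpose_apply, Pi.zero_apply] at h
    simp only [T, u, Matrix.mulVec, dotProduct, Matrix.transpose_apply, Matrix.map_apply,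
      Pi.zero_apply]
    exact_mod_cast h
  have hv : v ∈ LinearMap.ker T.mulVecLin := by
    rw [LinearMap.mem_ker, Matrix.mulVecLin_apply]
    funext k
    have h := congrFun hA0 k
    simp only [Matrix.mulVec, dotProduct, Pi.zero_apply] at h
    have h' : ∑ x, (A k x : ℚ) * a x = 0 := by exact_mod_cast h
    simp only [T, v, Matrix.mulVec, dotProduct, Matrix.transpose_apply, Matrix.map_apply,
      Pi.zero_apply]
    calc ∑ x, (A x k : ℚ) * (ε x * a x) = ∑ x, ε k * ((A k x : ℚ) * a x) :=
          Finset.sum_congr rfl fun x _ => by linear_combination (a x : ℚ) * hε x k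
      _ = 0 := by rw [← Finset.mul_sum, h', mul_zero]
  have hdim : Module.finrank ℚ (LinearMap.ker T.mulVecLin) = 1 := by
    have h := T.mulVecLin.finrank_range_add_finrank_ker
    have hr : Module.finrank ℚ (LinearMap.range T.mulVecLin) = r := by
      exact (Matrix.rank_transpose _).trans hA.rank_eq
    rw [hr, Module.finrank_fin_fun] at h
    omega
  have hu0 : (⟨u, hu⟩ : LinearMap.ker T.mulVecLin) ≠ 0 := by
    intro h
    have h1 : (c 0 : ℚ) = 0 := congrFun (congrArg Subtype.val h) 0
    have h2 := hc0 0
    have h3 : c 0 = 0 := by exact_mod_cast h1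
    omega
  obtain ⟨κ, hκ⟩ := (finrank_eq_one_iff_of_nonzero' _ hu0).1 hdim ⟨v, hv⟩
  have hκ' : ∀ k, κ * c k = ε k * a k := fun k => congrFun (congrArg Subtype.val hκ) k
  have hκ0 : κ ≠ 0 := by
    rintro rfl
    have h := hκ' 0
    rw [zero_mul, eq_comm, mul_eq_zero] at h
    rcases h with h | h
    · exact hε0 0 h
    · have h3 : a 0 = 0 := by exact_mod_cast h
      have := ha0 0
      omega
  have key : κ * ((c i : ℚ) * a j * A i j) = κ * (c j * a i * A j i) := by
    linear_combination (a j : ℚ) * A i j * hκ' i - (a i : ℚ) * A j i * hκ' j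
      + (a i : ℚ) * a j * hε i j
  exact_mod_cast mul_left_cancel₀ hκ0 key

theorem IsMarks.ne_zero (ha : IsMarks A a) (j : Fin (r + 1)) : (a j : ℂ) ≠ 0 := by
  exact_mod_cast (ha.1.1 j).ne'

theorem IsAffineGCM.div_mul_symm (hA : IsAffineGCM A) (ha : IsMarks A a)
    (hc : IsMarks A.transpose c) (i j : Fin (r + 1)) :
    (c i : ℂ) / a i * A i j = (c j : ℂ) / a j * A j i := by
  have h : (c i : ℂ) * a j * A i j = c j * a i * A j i := by exact_mod_cast hA.mul_symm ha hc i j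
  have hi := ha.ne_zero i
  have hj := ha.ne_zero j
  field_simp
  linear_combination h

/-- The normalized form is symmetric on the root lattice. -/
theorem form_toWeight_comm (hA : IsAffineGCM A) (ha : IsMarks A a) (hc : IsMarks A.transpose c)
    (g h : RootLattice r) : form a c (toWeight A g) h = form a c (toWeight A h) g := by
  simp only [form, toWeight_simpleCoroot, Matrix.mulVec, dotProduct, Int.cast_sum, Int.cast_mul,
    Finset.mul_sum]
  rw [Finset.sum_comm]
  refine Finset.sum_congr rfl fun i _ => Finset.sum_congr rfl fun j _ => ?_
  linear_combination (g i : ℂ) * h j * hA.div_mul_symm ha hc j i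

theorem form_marks (ha : IsMarks A a) (μ : Weight r) : form a c μ a = level c μ := by
  rw [form, level, map_sum]
  refine Finset.sum_congr rfl fun j _ => ?_
  rw [mul_div_cancel₀ _ (ha.ne_zero j), map_smul, smul_eq_mul]

theorem toWeight_marks_simpleCoroot (ha : IsMarks A a) (j : Fin (r + 1)) :
    toWeight A a (simpleCoroot j) = 0 := by
  rw [toWeight_simpleCoroot, ha.1.2]
  simp

theorem form_toWeight_marks (ha : IsMarks A a) (g : RootLattice r) :
    form a c (toWeight A a) g = 0 := by
  simp [form, toWeight_marks_simpleCoroot ha]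

theorem normSq_add_zsmul_marks (hA : IsAffineGCM A) (ha : IsMarks A a)
    (hc : IsMarks A.transpose c) (g : RootLattice r) (n : ℤ) :
    normSq A a c (g + n • a) = normSq A a c g := by
  simp only [normSq, toWeight_add, toWeight_zsmul, form_add, form_zsmul, form_weight_add,
    form_weight_smul, form_toWeight_marks ha, form_toWeight_comm hA ha hc g a, mul_zero, add_zero]

end Symmetry

/-! ### Real roots and integrality of their coroots -/

section RealRoots

theorem simpleReflection_eq (i : Fin (r + 1)) (g : RootLattice r) :
    simpleReflection A i g = g + (-(A.mulVec g i)) • Pi.single i 1 := by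
  rw [simpleReflection, neg_smul, sub_eq_add_neg]

theorem normSq_single (hA : IsAffineGCM A) (i : Fin (r + 1)) :
    normSq A a c (Pi.single i 1) = 2 * ((c i : ℂ) / a i) := by
  rw [normSq, form_single, toWeight_simpleCoroot]
  simp [hA.diag, mul_comm]

theorem normSq_simpleReflection (hA : IsAffineGCM A) (ha : IsMarks A a)
    (hc : IsMarks A.transpose c) (i : Fin (r + 1)) (g : RootLattice r) :
    normSq A a c (simpleReflection A i g) = normSq A a c g := by
  have h := normSq_single (a := a) (c := c) hA i
  rw [normSq] at h
  simp only [normSq, simpleReflection_eq, toWeight_add, toWeight_zsmul, form_add, form_zsmul,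
    form_weight_add, form_weight_smul, h, form_toWeight_comm hA ha hc (Pi.single i 1) g]
  rw [form_single, toWeight_simpleCoroot]
  push_cast
  ring

/-- A real root is not isotropic, and its coroot is an integral combination of the simple
coroots. -/
theorem IsRealRoot.exists_coroot (hA : IsAffineGCM A) (ha : IsMarks A a)
    (hc : IsMarks A.transpose c) {g : RootLattice r} (hg : IsRealRoot A g) :
    normSq A a c g ≠ 0 ∧ ∃ m : Fin (r + 1) → ℤ,
      ∀ j, 2 * ((g j : ℂ) * ((c j : ℂ) / a j)) = m j * normSq A a c g := by
  induction hg with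
  | simple i =>
    rw [normSq_single hA]
    refine ⟨mul_ne_zero two_ne_zero (div_ne_zero (hc.ne_zero i) (ha.ne_zero i)),
      Pi.single i 1, fun j => ?_⟩
    by_cases h : j = i
    · subst h
      simp
    · simp [h]
  | reflect i g _ ih =>
    obtain ⟨h0, m, hm⟩ := ih
    rw [normSq_simpleReflection hA ha hc]
    -- Here `m` holds the coordinates of `g^∨` in the simple coroots; reflecting subtracts `⟨α i,
    -- g^∨⟩` from the `i`-th one.
    refine ⟨h0, m - (∑ j, m j * A j i) • Pi.single i 1, fun j => ?_⟩
    by_cases h : j = i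
    · subst h
      -- Both sides are `2 (α j, g)`, computed in the two orders of the symmetric form.
      have key : 2 * ((c j : ℂ) / a j * (A.mulVec g j : ℂ)) =
          (∑ k, (m k : ℂ) * A k j) * normSq A a c g := by
        rw [← toWeight_simpleCoroot, ← form_single, ← form_toWeight_comm hA ha hc, form,
          Finset.mul_sum, Finset.sum_mul]
        refine Finset.sum_congr rfl fun k _ => ?_
        rw [toWeight_simpleCoroot, Matrix.mulVec_single_one, Matrix.col_apply]
        linear_combination (A k j : ℂ) * hm k
      simp only [simpleReflection, Pi.sub_apply, Pi.smul_apply, Pi.single_eq_same, smul_eq_mul,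
        mul_one]
      push_cast
      linear_combination hm j - key
    · simpa [simpleReflection, h] using hm j

theorem IsRealRoot.exists_corootPairing_eq (hA : IsAffineGCM A) (ha : IsMarks A a)
    (hc : IsMarks A.transpose c) {g : RootLattice r} (hg : IsRealRoot A g) {μ : Weight r}
    (hμ : ∀ j, ∃ n : ℤ, μ (simpleCoroot j) = n) : ∃ n : ℤ, (n : ℂ) = corootPairing A a c μ g := by
  obtain ⟨h0, m, hm⟩ := hg.exists_coroot hA ha hc
  choose n hn using hμ
  refine ⟨∑ j, m j * n j, ?_⟩
  rw [corootPairing, eq_div_iff h0, form, Finset.mul_sum]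
  push_cast
  rw [Finset.sum_mul]
  refine Finset.sum_congr rfl fun j _ => ?_
  rw [hn]
  linear_combination -(n j : ℂ) * hm j

theorem IsRealRoot.toWeight_ne_zero (hA : IsAffineGCM A) (ha : IsMarks A a)
    (hc : IsMarks A.transpose c) {g : RootLattice r} (hg : IsRealRoot A g) : toWeight A g ≠ 0 := by
  intro h
  refine (hg.exists_coroot hA ha hc).1 ?_
  simp [normSq, form, h]

/-- The shift by `n δ` leaves the norm alone and adds `n` times the level to the numerator, so
pairings are arithmetic progressions along a `δ`-string. -/
theorem corootPairing_add_zsmul_marks (hA : IsAffineGCM A) (ha : IsMarks A a)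
    (hc : IsMarks A.transpose c) (μ : Weight r) (g : RootLattice r) (n : ℤ) :
    corootPairing A a c μ (g + n • a) =
      corootPairing A a c μ g + n * (2 / normSq A a c g * level c μ) := by
  rw [corootPairing, normSq_add_zsmul_marks hA ha hc, form_add, form_zsmul, form_marks ha,
    corootPairing]
  ring

end RealRoots

/-! ### Dominance and mirrored weights along a string -/

section Mirrored

theorem dotReflection_eq_sub {ρ ν : Weight r} {g : RootLattice r} {m D : ℤ}
    (h : corootPairing A a c (ν + ρ) g = ((m + D : ℤ) : ℂ)) :
    dotReflection A a c ρ g m ν = ν - (D : ℂ) • toWeight A g := by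
  rw [dotReflection, affineReflection, h]
  push_cast
  module

theorem mem_dominantWeights_iff {μ : Weight r} :
    μ ∈ dominantWeights r ↔ ∀ j, ∃ n : ℤ, 0 ≤ n ∧ μ (simpleCoroot j) = n := by
  refine forall_congr' fun j => ⟨fun ⟨n, hn⟩ => ⟨n, by positivity, by exact_mod_cast hn⟩,
    fun ⟨n, h0, hn⟩ => ⟨n.toNat, ?_⟩⟩
  rw [hn]
  exact_mod_cast (Int.toNat_of_nonneg h0).symm

/-- Between a dominant weight and a dominant translate by a multiple of a root, the translates by
smaller multiples are dominant. -/
theorem sub_smul_mem_dominantWeights {μ : Weight r} {g : RootLattice r} {q D : ℤ}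
    (hμ : μ ∈ dominantWeights r) (hq : μ - (q : ℂ) • toWeight A g ∈ dominantWeights r)
    (h0 : 0 ≤ D) (hD : D ≤ q) : μ - (D : ℂ) • toWeight A g ∈ dominantWeights r := by
  rw [mem_dominantWeights_iff] at *
  intro j
  obtain ⟨n, hn0, hn⟩ := hμ j
  obtain ⟨k, hk0, hk⟩ := hq j
  simp only [LinearMap.sub_apply, LinearMap.smul_apply, toWeight_simpleCoroot, smul_eq_mul, hn]
    at hk ⊢
  have hk' : n - q * A.mulVec g j = k := by exact_mod_cast hk
  refine ⟨n - D * A.mulVec g j, ?_, by push_cast; ring⟩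
  -- The value is affine in `D`, so it is bounded below by its value at `D = q` or at `D = 0`,
  -- according to the sign of the slope.
  rcases le_total 0 (A.mulVec g j) with h | h <;> nlinarith

/-- Dominance only tests the simple coroots, where `δ` vanishes. -/
theorem sub_smul_add_zsmul_marks_mem (ha : IsMarks A a) {μ : Weight r} {g : RootLattice r} {z : ℂ}
    (n : ℤ) (h : μ - z • toWeight A g ∈ dominantWeights r) :
    μ - z • toWeight A (g + n • a) ∈ dominantWeights r := by
  intro j
  obtain ⟨k, hk⟩ := h j
  refine ⟨k, ?_⟩
  rw [← hk, toWeight_add, toWeight_zsmul]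
  simp [toWeight_marks_simpleCoroot ha]

theorem eq_sum_fundamentalWeight {μ : Weight r} (h : μ (scaling r) = 0) :
    μ = ∑ j, μ (simpleCoroot j) • fundamentalWeight j := by
  refine LinearMap.ext fun x => ?_
  have hx : x = ∑ j, x.1 j • simpleCoroot j + x.2 • scaling r := by
    refine Prod.ext ?_ ?_
    · funext k
      simp [simpleCoroot, scaling, Prod.fst_sum, Pi.single_apply]
    · simp [simpleCoroot, scaling, Prod.snd_sum]
  conv_lhs => rw [hx]
  simp [h, fundamentalWeight, mul_comm]

theorem mem_Yplus {ρ μ : Weight r} {p : ℕ} (hμ : μ ∈ dominantWeights r)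
    (h0 : μ (scaling r) = 0)
    (h : ∃ ν ∈ dominantWeights r, ∃ g, IsPosRealRoot A g ∧ IsMirrored A a c ρ p g ν μ) :
    μ ∈ Yplus A a c ρ p := by
  choose n hn using hμ
  refine ⟨⟨n, ?_⟩, h⟩
  conv_lhs => rw [eq_sum_fundamentalWeight h0]
  simp only [hn]

theorem isPosRealRoot_of_mem_baseRoots (ha : IsMarks A a) {i : ℕ} {g : RootLattice r}
    (hg : g ∈ baseRoots A a i) (k : ℕ) : IsPosRealRoot A (g + ((k : ℤ) * i) • a) := by
  refine ⟨(hg.2.1 _).2 (dvd_mul_left _ _), fun j => ?_⟩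
  have h1 := hg.1.2 j
  have h2 := ha.1.1 j
  simp only [Pi.add_apply, Pi.smul_apply, smul_eq_mul]
  positivity

/-- If a member of the `δ`-string of `γ₀` pairs to `D` modulo `p ^ e`, with `0 ≤ D ≤ q`,
`D < p ^ e` and `lam - q γ₀` dominant, then that member mirrors `lam` to a dominant weight. -/
theorem exists_isMirrored (hA : IsAffineGCM A) (ha : IsMarks A a) (hc : IsMarks A.transpose c)
    {ρ lam : Weight r} {p i : ℕ} {γ₀ : RootLattice r} (hγ₀ : γ₀ ∈ baseRoots A a i)
    (hlam : lam ∈ dominantWeights r) {C N : ℤ}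
    (hpair : ∀ k : ℕ, corootPairing A a c (lam + ρ) (γ₀ + ((k : ℤ) * i) • a) =
      ((N + k * C : ℤ) : ℂ))
    {e k : ℕ} (he : 0 < e) {q D M : ℤ} (hq : lam - (q : ℂ) • toWeight A γ₀ ∈ dominantWeights r)
    (hD0 : 0 ≤ D) (hDq : D ≤ q) (hDe : D < (p : ℤ) ^ e) (hk : N + k * C = M * (p : ℤ) ^ e + D) :
    ∃ μ ∈ dominantWeights r, (D ≠ 0 → μ ≠ lam) ∧
      ∃ γ, IsPosRealRoot A γ ∧ IsMirrored A a c ρ p γ μ lam := by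
  have hroot := isPosRealRoot_of_mem_baseRoots ha hγ₀ k
  have hμ := sub_smul_add_zsmul_marks_mem ha ((k : ℤ) * i)
    (sub_smul_mem_dominantWeights hlam hq hD0 hDq)
  have hp := hpair k
  rw [hk] at hp
  refine ⟨_, hμ, fun hD h => ?_, _, hroot, e, he, hμ, hlam, M, D, hp, hD0, hDe,
    (dotReflection_eq_sub hp).symm⟩
  rw [sub_eq_self, smul_eq_zero] at h
  rcases h with h | h
  · exact hD (by exact_mod_cast h)
  · exact hroot.1.toWeight_ne_zero hA ha hc h

end Mirrored

/-- An arithmetic progression with difference `C` meets every residue class modulo `m` congruent to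
its first term modulo `gcd C m`. -/
theorem exists_nat_add_mul_eq {C N D m : ℤ} (hm : 0 < m) (h : (Int.gcd C m : ℤ) ∣ D - N) :
    ∃ (k : ℕ) (M : ℤ), N + k * C = M * m + D := by
  obtain ⟨t, ht⟩ := h
  have hb := Int.gcd_eq_gcd_ab C m
  set x := Int.gcdA C m
  set y := Int.gcdB C m
  -- By Bézout `t * x` solves the congruence; reducing it modulo `m` makes it nonnegative, as
  -- positivity of the shifted root requires, and the quotient goes into `M`.
  refine ⟨(t * x % m).toNat, -(t * y) - t * x / m * C, ?_⟩
  rw [Int.toNat_of_nonneg (Int.emod_nonneg _ hm.ne'), Int.emod_def]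
  linear_combination -ht - t * hb

end AffineWeyl

/-! ### The proposition -/

open AffineWeyl in
theorem mainTheorem8 {r : ℕ} (A : Matrix (Fin (r + 1)) (Fin (r + 1)) ℤ) (hA : IsAffineGCM A)
    (a c : Fin (r + 1) → ℤ) (ha : IsMarks A a) (hc : IsMarks A.transpose c)
    (ρ : Weight r) (hρ : ∀ i, ρ (simpleCoroot i) = 1)
    (p : ℕ) (hp : p.Prime)
    (lam : Weight r) (hlam : lam ∈ dominantWeights r) (l : ℤ) (hl : level c lam = (l : ℂ))
    (i : ℕ) (hi : i = 1 ∨ i = 2 ∨ i = 3) (γ₀ : RootLattice r) (hγ₀ : γ₀ ∈ baseRoots A a i) :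
    ∃ C N : ℤ,
      (C : ℂ) = 2 * (i : ℂ) / normSq A a c γ₀ * ((l : ℂ) + ∑ j, (c j : ℂ)) ∧
      (N : ℂ) = corootPairing A a c (lam + ρ) γ₀ ∧
      -- the implication with the definition of mirrored weights as it stands
      (lam - (Int.gcd C p : ℂ) • toWeight A γ₀ ∈ dominantWeights r →
        (∃ μ ∈ dominantWeights r, ∃ γ, IsPosRealRoot A γ ∧ IsMirrored A a c ρ p γ μ lam) ∧
        (lam (scaling r) = 0 → lam ∈ Yplus A a c ρ p)) ∧
      -- the same with a mirrored weight different from `lam`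
      (lam - (Int.gcd C p : ℂ) • toWeight A γ₀ ∈ dominantWeights r →
        ¬ ((p : ℤ) ^ 2 ∣ C ∧ (p : ℤ) ∣ N) →
        ∃ μ ∈ dominantWeights r, μ ≠ lam ∧
          ∃ γ, IsPosRealRoot A γ ∧ IsMirrored A a c ρ p γ μ lam) ∧
      -- the same with a power `p ^ e` that does not divide `C`
      (∀ e : ℕ, ¬ (p : ℤ) ^ e ∣ C →
        lam - (Int.gcd C ((p : ℤ) ^ e) : ℂ) • toWeight A γ₀ ∈ dominantWeights r →
        ∃ μ ∈ dominantWeights r, μ ≠ lam ∧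
          ∃ γ, IsPosRealRoot A γ ∧ IsMirrored A a c ρ p γ μ lam) := by
  have hper : IsRealRoot A (γ₀ + (i : ℤ) • a) := (hγ₀.2.1 _).2 dvd_rfl
  have hintegral : ∀ j, ∃ n : ℤ, (lam + ρ) (simpleCoroot j) = n := fun j => by
    obtain ⟨n, hn⟩ := hlam j
    exact ⟨n + 1, by simp [hn, hρ]⟩
  have hlev : level c (lam + ρ) = (l : ℂ) + ∑ j, (c j : ℂ) := by
    rw [level, LinearMap.add_apply]
    congr 1
    simp [hρ]
  obtain ⟨N, hN⟩ := hγ₀.1.1.exists_corootPairing_eq hA ha hc hintegral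
  obtain ⟨N', hN'⟩ := hper.exists_corootPairing_eq hA ha hc hintegral
  obtain ⟨C, hC⟩ : ∃ C : ℤ, (C : ℂ) =
      2 * (i : ℂ) / normSq A a c γ₀ * ((l : ℂ) + ∑ j, (c j : ℂ)) := by
    -- `C` is the difference of the integral pairings with the two real roots `γ₀ + i δ` and `γ₀`.
    refine ⟨N' - N, ?_⟩
    rw [Int.cast_sub, hN', hN, corootPairing_add_zsmul_marks hA ha hc, hlev]
    push_cast
    ring
  have hpair : ∀ k : ℕ, corootPairing A a c (lam + ρ) (γ₀ + ((k : ℤ) * i) • a) =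
      ((N + k * C : ℤ) : ℂ) := fun k => by
    rw [corootPairing_add_zsmul_marks hA ha hc, hlev]
    push_cast
    rw [hN, hC]
    ring
  have hp0 : ∀ e : ℕ, 0 < (p : ℤ) ^ e := fun e => pow_pos (by exact_mod_cast hp.pos) e
  have hp1 : ∀ e : ℕ, (p : ℤ) ^ e < (p : ℤ) ^ (e + 1) := fun e =>
    pow_lt_pow_right₀ (by exact_mod_cast hp.one_lt) e.lt_succ_self
  have hmod : ∀ f : ℕ, 0 < f → lam - (((p : ℤ) ^ f : ℤ) : ℂ) • toWeight A γ₀ ∈ dominantWeights r →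
      ∃ μ ∈ dominantWeights r, (N % (p : ℤ) ^ f ≠ 0 → μ ≠ lam) ∧
        ∃ γ, IsPosRealRoot A γ ∧ IsMirrored A a c ρ p γ μ lam := fun f hf hdom => by
    have hlt := Int.emod_lt_of_pos N (hp0 f)
    refine exists_isMirrored (k := 0) (M := N / (p : ℤ) ^ f) hA ha hc hγ₀ hlam hpair hf hdom
      (Int.emod_nonneg _ (hp0 f).ne') hlt.le hlt ?_
    have := Int.emod_add_mul_ediv N ((p : ℤ) ^ f)
    push_cast
    linear_combination -this
  have hpow : ∀ e : ℕ, ¬ (p : ℤ) ^ e ∣ C →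
      lam - (Int.gcd C ((p : ℤ) ^ e) : ℂ) • toWeight A γ₀ ∈ dominantWeights r →
      ∃ μ ∈ dominantWeights r, μ ≠ lam ∧
        ∃ γ, IsPosRealRoot A γ ∧ IsMirrored A a c ρ p γ μ lam := by
    intro e he hdom
    obtain ⟨f, hfe, hf⟩ : ∃ f ≤ e, Int.gcd C ((p : ℤ) ^ e) = p ^ f := by
      refine (Nat.dvd_prime_pow hp).1 ?_
      have h := Int.gcd_dvd_right C ((p : ℤ) ^ e)
      exact_mod_cast h
    have hfC : (p : ℤ) ^ f ∣ C := by
      have h := Int.gcd_dvd_left C ((p : ℤ) ^ e)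
      rw [hf] at h
      exact_mod_cast h
    have hlt : f < e := lt_of_le_of_ne hfe (by rintro rfl; exact he hfC)
    -- This is where `f < e` enters: `gcd(C, p ^ (f + 1))` is still only `p ^ f`, so residues modulo
    -- `p ^ (f + 1)` can be moved in steps of `p ^ f`.
    have hg : (Int.gcd C ((p : ℤ) ^ (f + 1)) : ℤ) ∣ (p : ℤ) ^ f := by
      have h : (Int.gcd C ((p : ℤ) ^ (f + 1)) : ℤ) ∣ Int.gcd C ((p : ℤ) ^ e) :=
        Int.dvd_coe_gcd (Int.gcd_dvd_left ..)
          ((Int.gcd_dvd_right ..).trans (pow_dvd_pow _ hlt))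
      rw [hf] at h
      exact_mod_cast h
    rw [hf] at hdom
    replace hdom : lam - (((p : ℤ) ^ f : ℤ) : ℂ) • toWeight A γ₀ ∈ dominantWeights r := by
      exact_mod_cast hdom
    by_cases hfN : (p : ℤ) ^ f ∣ N
    · obtain ⟨k, M, hk⟩ := exists_nat_add_mul_eq (C := C) (hp0 (f + 1))
        (hg.trans (dvd_sub_self_left.2 hfN))
      obtain ⟨μ, hμ, hne, h⟩ := exists_isMirrored hA ha hc hγ₀ hlam hpair f.succ_pos hdom
        (hp0 f).le le_rfl (hp1 f) hk
      exact ⟨μ, hμ, hne (hp0 f).ne', h⟩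
    · have hf0 : 0 < f := Nat.pos_of_ne_zero (by rintro rfl; simp at hfN)
      obtain ⟨μ, hμ, hne, h⟩ := hmod f hf0 hdom
      exact ⟨μ, hμ, hne fun h0 => hfN (Int.dvd_of_emod_eq_zero h0), h⟩
  have hgcd : (p : ℤ) ∣ C → Int.gcd C p = p := fun h => by
    simpa using Int.gcd_eq_right (Int.natCast_nonneg p) h
  have hone : (p : ℤ) ∣ C → lam - (Int.gcd C p : ℂ) • toWeight A γ₀ ∈ dominantWeights r →
      ∃ μ ∈ dominantWeights r, (N % (p : ℤ) ^ 1 ≠ 0 → μ ≠ lam) ∧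
        ∃ γ, IsPosRealRoot A γ ∧ IsMirrored A a c ρ p γ μ lam := fun hpC hdom => by
    rw [hgcd hpC] at hdom
    exact hmod 1 one_pos (by simpa using hdom)
  have hfirst : lam - (Int.gcd C p : ℂ) • toWeight A γ₀ ∈ dominantWeights r →
      ∃ μ ∈ dominantWeights r, ∃ γ, IsPosRealRoot A γ ∧ IsMirrored A a c ρ p γ μ lam := by
    intro hdom
    by_cases hpC : (p : ℤ) ∣ C
    · obtain ⟨μ, hμ, -, h⟩ := hone hpC hdom
      exact ⟨μ, hμ, h⟩
    · obtain ⟨μ, hμ, -, h⟩ := hpow 1 (by simpa using hpC) (by simpa using hdom)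
      exact ⟨μ, hμ, h⟩
  refine ⟨C, N, hC, hN, fun hdom => ⟨hfirst hdom, fun h0 => mem_Yplus hlam h0 (hfirst hdom)⟩,
    fun hdom hnot => ?_, hpow⟩
  by_cases hpC : (p : ℤ) ∣ C
  · by_cases hpN : (p : ℤ) ∣ N
    · have hp2 : ¬ (p : ℤ) ^ 2 ∣ C := fun h => hnot ⟨h, hpN⟩
      obtain ⟨k, hk, hk'⟩ : ∃ k ≤ 2, Int.gcd C ((p : ℤ) ^ 2) = p ^ k := by
        refine (Nat.dvd_prime_pow hp).1 ?_
        have h := Int.gcd_dvd_right C ((p : ℤ) ^ 2)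
        exact_mod_cast h
      have h1 : p ∣ p ^ k := by
        rw [← hk']
        exact_mod_cast Int.dvd_coe_gcd hpC (dvd_pow_self (p : ℤ) two_ne_zero)
      have h2 : (p : ℤ) ^ k ∣ C := by
        have h := Int.gcd_dvd_left C ((p : ℤ) ^ 2)
        rw [hk'] at h
        exact_mod_cast h
      obtain rfl : k = 1 := by
        interval_cases k
        · exact absurd (Nat.dvd_one.1 (by simpa using h1)) hp.one_lt.ne'
        · rfl
        · exact absurd h2 hp2
      refine hpow 2 hp2 ?_
      rwa [hk', pow_one, ← hgcd hpC]
    · obtain ⟨μ, hμ, hne, h⟩ := hone hpC hdom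
      exact ⟨μ, hμ, hne fun h0 => hpN (Int.dvd_of_emod_eq_zero (by simpa using h0)), h⟩
  · exact hpow 1 (by simpa using hpC) (by simpa using hdom)
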